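/- Fix an integer $n\ge 3$ and a real number $\sigma\in(1,n-1)$. Let $\mathcal Q$ be the collection of all $(n-1)$-dimensional cubes $$Q=[2^m j_1,2^m(j_1+1)]\times\cdots\times[2^m j_{n-1},2^m(j_{n-1}+1)]\times\{0\}\subset\mathbb R^{n-1}\times\{0\},\qquad m,j_1,\dots,j_{n-1}\in\mathbb Z,$$ and let $|Q|$ denote the $(n-1)$-dimensional volume of $Q$. There is a constant $C>0$, depending only on $n$ and $\sigma$, with the following property. Let $V$ be a nonnegative continuous function on $\mathbb R^{n-1}\times\{0\}$ such that $$\Big(|Q|^{-1}\int_Q V^\sigma\Big)^{1/\sigma}\le \operatorname{diam}(Q)^{-1}\qquad\text{for every } Q\in\mathcal Q.$$ Let $F$ be a real-valued function on the closed half-space $\mathbb R^n_+=\{x\in\mathbb R^n: x_n\ge 0\}$ that is smooth up to the boundary, and let $f$ denote the restriction of $F$ to $\partial\mathbb R^n_+=\mathbb R^{n-1}\times\{0\}$. Then, for every $Q\in\mathcal Q$, $$\int_Q V f^2\le C\int_{Q\times[0,\operatorname{diam}(Q)]}|\nabla F|^2+C\,\operatorname{diam}(Q)^{-1}\int_Q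 f^2 .$$ Here $Q\times[0,\operatorname{diam}(Q)]$ denotes the set of all $(y,t)$ with $(y,0)\in Q$ and $0\le t\le\operatorname{diam}(Q)$. -/

import Mathlib

open MeasureTheory
open scoped ContDiff

/-- The closed cube `[2^m j₁, 2^m (j₁+1)] × ⋯ × [2^m j_d, 2^m (j_d+1)]` in `ℝ^d`. -/
def dyadicCube {d : ℕ} (m : ℤ) (j : Fin d → ℤ) : Set (EuclideanSpace ℝ (Fin d)) :=
  {x | ∀ i, x i ∈ Set.Icc ((2 : ℝ) ^ m * (j i : ℝ)) ((2 : ℝ) ^ m * ((j i : ℝ) + 1))}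

/-- The collection of all closed dyadic cubes in `ℝ^d`. -/
def dyadicCubes (d : ℕ) : Set (Set (EuclideanSpace ℝ (Fin d))) :=
  {Q | ∃ (m : ℤ) (j : Fin d → ℤ), Q = dyadicCube m j}

/-- The closed half-space of all points of `ℝ^(d+1)` whose last coordinate is nonnegative. -/
def halfSpace (d : ℕ) : Set (EuclideanSpace ℝ (Fin (d + 1))) :=
  {x | 0 ≤ x (Fin.last d)}

/-- The identification `x ↦ (x, 0)` of `ℝ^d` with the hyperplane `ℝ^d × {0}` in `ℝ^(d+1)`. -/
def boundaryPoint {d : ℕ} (x : EuclideanSpace ℝ (Fin d)) : EuclideanSpace ℝ (Fin (d + 1)) :=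
  WithLp.toLp 2 (Fin.snoc (α := fun _ => ℝ) (fun i => x i) 0)

/-- The product `Q × [0, h]` as a subset of `ℝ^(d+1)`. -/
def cubeCylinder {d : ℕ} (Q : Set (EuclideanSpace ℝ (Fin d))) (h : ℝ) :
    Set (EuclideanSpace ℝ (Fin (d + 1))) :=
  {x | WithLp.toLp 2 (fun i : Fin d => x i.castSucc) ∈ Q ∧ x (Fin.last d) ∈ Set.Icc 0 h}

/-!
The proof is an induction over dyadic generations, with a Bellman function, after a reduction to
slice averages.

For a cube `Q` with side `ℓ` let `c Q` be the mean of `F` over `Q × {ℓ}`. The dilation with factor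
`1 / 2` about a vertex of `Q` at height zero takes `Q × {ℓ}` to the corresponding set over a dyadic
child `Q'` of `Q`, so `ℓ ^ (d - 1) * (c Q' - c Q) ^ 2` is at most a multiple of the energy of `F` in
`Q × [ℓ / 2, ℓ]` (`sq_sliceAverage_child_sub_le`). These slabs do not overlap as `Q` runs over the
dyadic cubes, so the energies add up to the energy of the whole box (`slabEnergy_split`). Since
`c Q → f` uniformly as `ℓ → 0` (`exists_sq_le_sliceAverage_sq_add`), it remains to sum the
differences `c Q' - c Q` against the weight `V`.

Put `L = ℓ ^ (d - 1)`, `m Q = ∫_Q V` and `φ Q = ℓ ^ (s - 1) * ∫_Q V ^ s` with `s = min σ 2`. The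
claim propagated from the children to the parent is
`∫_Q V f² ≤ (m Q + φ Q) * (c Q)² + B * energy`
(`integral_mul_sq_le_of_generation`). The sum of `m + φ` over the children of `Q` is
`m Q + 2 ^ (1 - s) * φ Q`, so each step leaves a surplus `(1 - 2 ^ (1 - s)) * φ Q * (c Q)²`; here
`σ > 1` enters. The surplus absorbs the cross terms `2 * (c Q) * (c Q' - c Q) * (m Q + φ Q)` because
`(m Q + φ Q) ^ 2 ≤ 4 * L * φ Q` (`bellman_step`), which follows from Jensen's inequality, the Morrey
bound `φ Q ≤ L`, and `s ≤ 2` (`morreyPotential_le`, `sq_integral_le_mul_morreyPotential`). At the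
initial cube `m Q + φ Q ≤ 2 * L`, and `L` times the square of the difference of `c Q` and the mean
of `f` over `Q` is bounded by a multiple of the energy (`sq_sliceAverage_sub_boundary_le`).
-/

/-! ### Cubes given by a corner and a side length -/

/-- The closed cube in `ℝ^d` with lower corner `p` and side length `ℓ`. Here `ℝ^d` is the plain
product `Fin d → ℝ`, whose volume is the Lebesgue measure of `EuclideanSpace ℝ (Fin d)`. -/
def cornerCube {d : ℕ} (p : Fin d → ℝ) (ℓ : ℝ) : Set (Fin d → ℝ) :=
  Set.Icc p (fun i => p i + ℓ)

/-- The lower corner of the dyadic child, with label `e`, of the cube with corner `p` and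
side `ℓ`. -/
noncomputable def childCorner {d : ℕ} (p : Fin d → ℝ) (ℓ : ℝ) (e : Fin d → Fin 2) : Fin d → ℝ :=
  fun i => p i + ℓ / 2 * ((e i : ℕ) : ℝ)

/-- The vertex that a cube shares with its dyadic child with label `e`. -/
def commonVertex {d : ℕ} (p : Fin d → ℝ) (ℓ : ℝ) (e : Fin d → Fin 2) : Fin d → ℝ :=
  fun i => p i + ℓ * ((e i : ℕ) : ℝ)

section Cubes

variable {d : ℕ}

lemma mem_cornerCube {p x : Fin d → ℝ} {ℓ : ℝ} :
    x ∈ cornerCube p ℓ ↔ ∀ i, p i ≤ x i ∧ x i ≤ p i + ℓ := by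
  simp only [cornerCube, Set.mem_Icc, Pi.le_def]
  exact ⟨fun h i => ⟨h.1 i, h.2 i⟩, fun h => ⟨fun i => (h i).1, fun i => (h i).2⟩⟩

lemma isCompact_cornerCube (p : Fin d → ℝ) (ℓ : ℝ) : IsCompact (cornerCube p ℓ) :=
  isCompact_Icc

lemma measurableSet_cornerCube (p : Fin d → ℝ) (ℓ : ℝ) : MeasurableSet (cornerCube p ℓ) :=
  measurableSet_Icc

lemma volume_real_cornerCube (p : Fin d → ℝ) {ℓ : ℝ} (hℓ : 0 ≤ ℓ) :
    volume.real (cornerCube p ℓ) = ℓ ^ d := by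
  rw [Measure.real, cornerCube, Real.volume_Icc_pi_toReal (fun i => by simpa using hℓ)]
  simp

lemma Continuous.integrableOn_cornerCube {g : (Fin d → ℝ) → ℝ} (hg : Continuous g)
    (p : Fin d → ℝ) (ℓ : ℝ) : IntegrableOn g (cornerCube p ℓ) :=
  hg.continuousOn.integrableOn_compact (isCompact_cornerCube p ℓ)

lemma childCorner_cube_subset {p : Fin d → ℝ} {ℓ : ℝ} (hℓ : 0 ≤ ℓ) (e : Fin d → Fin 2) :
    cornerCube (childCorner p ℓ e) (ℓ / 2) ⊆ cornerCube p ℓ := by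
  intro x hx
  rw [mem_cornerCube] at hx ⊢
  intro i
  have h := hx i
  simp only [childCorner] at h
  have h0 : (0 : ℝ) ≤ ((e i : ℕ) : ℝ) := by positivity
  have h1 : ((e i : ℕ) : ℝ) ≤ 1 := by exact_mod_cast Nat.lt_succ_iff.1 (e i).2
  constructor <;> nlinarith

/-- Integration over a cube is integration over its dyadic children; the children overlap in null
sets only, as one sees by passing to half-open cubes. -/
lemma sum_integral_children {g : (Fin d → ℝ) → ℝ} (hg : Continuous g) (p : Fin d → ℝ) {ℓ : ℝ}
    (hℓ : 0 < ℓ) :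
    ∑ e : Fin d → Fin 2, ∫ x in cornerCube (childCorner p ℓ e) (ℓ / 2), g x
      = ∫ x in cornerCube p ℓ, g x := by
  have key : ∀ (q : Fin d → ℝ) (r : ℝ), ∫ x in cornerCube q r, g x
      = ∫ x in Set.univ.pi (fun i => Set.Ico (q i) (q i + r)), g x := fun q r =>
    (setIntegral_congr_set Measure.univ_pi_Ico_ae_eq_Icc).symm
  simp only [key]
  rw [← integral_iUnion_fintype]
  · congr 2
    ext x
    simp only [Set.mem_iUnion, Set.mem_univ_pi, Set.mem_Ico, childCorner]
    constructor
    · rintro ⟨e, he⟩ i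
      have h := he i
      have h0 : (0 : ℝ) ≤ ((e i : ℕ) : ℝ) := by positivity
      have h1 : ((e i : ℕ) : ℝ) ≤ 1 := by exact_mod_cast Nat.lt_succ_iff.1 (e i).2
      constructor <;> nlinarith
    · intro h
      refine ⟨fun i => if x i < p i + ℓ / 2 then 0 else 1, fun i => ?_⟩
      have := h i
      by_cases hi : x i < p i + ℓ / 2
      · simpa [hi] using this.1
      · simp only [hi, if_false, Fin.val_one, Nat.cast_one, mul_one]
        constructor <;> linarith
  · exact fun e => MeasurableSet.univ_pi fun i => measurableSet_Ico
  · intro e e' hee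
    rw [Function.onFun, Set.disjoint_left]
    intro x hx hx'
    apply hee
    ext i
    have h := hx i trivial
    have h' := hx' i trivial
    simp only [childCorner, Set.mem_Ico] at h h'
    have a : ((e i : ℕ) : ℝ) < (e' i : ℕ) + 1 := by nlinarith
    have b : ((e' i : ℕ) : ℝ) < (e i : ℕ) + 1 := by nlinarith
    norm_cast at a b
    omega
  · exact fun e => (hg.integrableOn_cornerCube (childCorner p ℓ e) (ℓ / 2)).mono_set
      (fun x hx => mem_cornerCube.2 fun i => ⟨(hx i trivial).1, (hx i trivial).2.le⟩)

/-- Change of variables for a dilation followed by a translation. -/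
lemma integral_cornerCube_comp_affine (g : (Fin d → ℝ) → ℝ) (p w : Fin d → ℝ) (ℓ : ℝ)
    {τ : ℝ} (hτ : 0 < τ) :
    ∫ x in cornerCube p ℓ, g (τ • x + w)
      = (τ ^ d)⁻¹ * ∫ x in cornerCube (τ • p + w) (τ * ℓ), g x := by
  have h1 := Measure.setIntegral_comp_smul_of_pos (μ := (volume : Measure (Fin d → ℝ)))
    (fun y => g (y + w)) (cornerCube p ℓ) hτ
  rw [h1, Module.finrank_fin_fun, smul_eq_mul]
  congr 1
  rw [← (measurePreserving_add_right volume w).setIntegral_preimage_emb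
    (measurableEmbedding_addRight w) g (cornerCube (τ • p + w) (τ * ℓ))]
  congr 2
  ext x
  rw [Set.mem_smul_set_iff_inv_smul_mem₀ hτ.ne', Set.mem_preimage, mem_cornerCube, mem_cornerCube]
  refine forall_congr' fun i => ?_
  simp only [Pi.smul_apply, smul_eq_mul, Pi.add_apply, inv_mul_eq_div, le_div_iff₀ hτ,
    div_le_iff₀ hτ]
  constructor <;> rintro ⟨h, h'⟩ <;> constructor <;> nlinarith

/-- Jensen's inequality for powers on a cube. -/
lemma rpow_average_le {g : (Fin d → ℝ) → ℝ} (hg : Continuous g) (h0 : ∀ x, 0 ≤ g x) {r : ℝ}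
    (hr : 1 ≤ r) (p : Fin d → ℝ) {ℓ : ℝ} (hℓ : 0 < ℓ) :
    ((ℓ ^ d)⁻¹ * ∫ x in cornerCube p ℓ, g x) ^ r
      ≤ (ℓ ^ d)⁻¹ * ∫ x in cornerCube p ℓ, g x ^ r := by
  have hgr : Continuous fun x => g x ^ r := hg.rpow_const fun x => Or.inr (by linarith)
  have hv : volume.real (cornerCube p ℓ) ≠ 0 := by
    rw [volume_real_cornerCube p hℓ.le]; positivity
  have h := (convexOn_rpow hr).map_set_average_le (μ := volume) (t := cornerCube p ℓ) (f := g)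
    (Real.continuous_rpow_const (by linarith)).continuousOn isClosed_Ici
    (fun h => hv (by simp [Measure.real, h])) (isCompact_cornerCube p ℓ).measure_lt_top.ne
    (Filter.Eventually.of_forall h0) (hg.integrableOn_cornerCube p ℓ)
    (hgr.integrableOn_cornerCube p ℓ)
  simpa only [setAverage_eq, volume_real_cornerCube p hℓ.le, smul_eq_mul] using h

lemma sq_integral_cornerCube_le {g : (Fin d → ℝ) → ℝ} (hg : Continuous g)
    (p : Fin d → ℝ) {ℓ : ℝ} (hℓ : 0 < ℓ) :
    ((ℓ ^ d)⁻¹ * ∫ x in cornerCube p ℓ, g x) ^ 2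
      ≤ (ℓ ^ d)⁻¹ * ∫ x in cornerCube p ℓ, g x ^ 2 := by
  have hv : volume.real (cornerCube p ℓ) ≠ 0 := by
    rw [volume_real_cornerCube p hℓ.le]; positivity
  have h := (even_two.convexOn_pow (𝕜 := ℝ)).map_set_average_le (μ := volume)
    (t := cornerCube p ℓ) (f := g)
    (continuous_pow 2).continuousOn isClosed_univ
    (fun h => hv (by simp [Measure.real, h])) (isCompact_cornerCube p ℓ).measure_lt_top.ne
    (by simp) (hg.integrableOn_cornerCube p ℓ)
    ((hg.pow 2).integrableOn_cornerCube p ℓ)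
  simpa only [setAverage_eq, volume_real_cornerCube p hℓ.le, smul_eq_mul] using h

lemma sq_intervalIntegral_le {k : ℝ → ℝ} (hk : Continuous k) :
    (∫ t in (0 : ℝ)..1, k t) ^ 2 ≤ ∫ t in (0 : ℝ)..1, k t ^ 2 := by
  have h := (even_two.convexOn_pow (𝕜 := ℝ)).map_set_average_le (μ := volume)
    (t := Set.Ioc (0 : ℝ) 1) (f := k)
    (continuous_pow 2).continuousOn isClosed_univ (by simp) (by simp)
    (by simp) (hk.integrableOn_Ioc) ((hk.pow 2).integrableOn_Ioc)
  simpa [setAverage_eq, intervalIntegral.integral_of_le] using h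

lemma continuous_integral_cornerCube {g : ℝ → (Fin d → ℝ) → ℝ} (hg : Continuous g.uncurry)
    (p : Fin d → ℝ) (ℓ : ℝ) : Continuous fun t => ∫ x in cornerCube p ℓ, g t x :=
  continuous_parametric_integral_of_continuous hg (isCompact_cornerCube p ℓ)

lemma integral_cornerCube_swap {g : ℝ → (Fin d → ℝ) → ℝ} (hg : Continuous g.uncurry)
    (p : Fin d → ℝ) (ℓ a b : ℝ) :
    ∫ x in cornerCube p ℓ, ∫ t in a..b, g t x = ∫ t in a..b, ∫ x in cornerCube p ℓ, g t x := by
  refine (intervalIntegral_integral_swap ?_).symm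
  rw [Measure.prod_restrict]
  refine (hg.continuousOn.integrableOn_compact
    ((isCompact_uIcc (a := a) (b := b)).prod (isCompact_cornerCube p ℓ))).mono_set ?_
  exact Set.prod_mono Set.uIoc_subset_uIcc le_rfl

end Cubes

/-! ### Averages over horizontal slices -/

/-- The function `H` dominates the slope of `G` on the half-space `t ≥ 0` of `ℝ × ℝ^d`: increments
of `G` along a segment, of size at most `r` in each coordinate, are at most `M * r` times the mean
of `H` over the segment. The height is the first argument of both functions. -/
def HasSlopeBound {d : ℕ} (M : ℝ) (G H : ℝ → (Fin d → ℝ) → ℝ) : Prop :=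
  ∀ (s₀ s₁ : ℝ) (x₀ x₁ : Fin d → ℝ) (r : ℝ), 0 ≤ s₀ → 0 ≤ s₁ → |s₁ - s₀| ≤ r →
    (∀ i, |x₁ i - x₀ i| ≤ r) →
      |G s₁ x₁ - G s₀ x₀| ≤ M * r * ∫ t in (0 : ℝ)..1, H (s₀ + t * (s₁ - s₀)) (x₀ + t • (x₁ - x₀))

/-- The mean of `G` over the top face of the box over the cube with corner `p` and side `ℓ`,
that is, over the copy of this cube at height `ℓ`. -/
noncomputable def sliceAverage {d : ℕ} (G : ℝ → (Fin d → ℝ) → ℝ) (p : Fin d → ℝ) (ℓ : ℝ) : ℝ :=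
  (ℓ ^ d)⁻¹ * ∫ x in cornerCube p ℓ, G ℓ x

/-- The integral of `H ^ 2` over the part with heights between `a` and `b` of the cylinder over the
cube with corner `p` and side `ℓ`. -/
noncomputable def slabEnergy {d : ℕ} (H : ℝ → (Fin d → ℝ) → ℝ) (p : Fin d → ℝ) (ℓ a b : ℝ) : ℝ :=
  ∫ s in a..b, ∫ x in cornerCube p ℓ, H s x ^ 2

section Slices

variable {d : ℕ} {G H : ℝ → (Fin d → ℝ) → ℝ} {M : ℝ}

lemma continuous_sq_uncurry (hH : Continuous H.uncurry) :
    Continuous (Function.uncurry fun s x => H s x ^ 2) :=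
  hH.pow 2

lemma continuous_integral_sq (hH : Continuous H.uncurry) (p : Fin d → ℝ) (ℓ : ℝ) :
    Continuous fun s => ∫ x in cornerCube p ℓ, H s x ^ 2 :=
  continuous_integral_cornerCube (continuous_sq_uncurry hH) p ℓ

lemma slabEnergy_nonneg (p : Fin d → ℝ) (ℓ : ℝ) {a b : ℝ} (hab : a ≤ b) :
    0 ≤ slabEnergy H p ℓ a b :=
  intervalIntegral.integral_nonneg hab fun _ _ => integral_nonneg fun _ => sq_nonneg _

/-- The energy in the lower half of a box is the sum of the energies of the boxes over the
children. -/
lemma slabEnergy_split (hH : Continuous H.uncurry) (p : Fin d → ℝ) {ℓ : ℝ} (hℓ : 0 < ℓ) :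
    ∑ e : Fin d → Fin 2, slabEnergy H (childCorner p ℓ e) (ℓ / 2) 0 (ℓ / 2)
      + slabEnergy H p ℓ (ℓ / 2) ℓ = slabEnergy H p ℓ 0 ℓ := by
  have hc := fun q r => continuous_integral_sq hH q r
  unfold slabEnergy
  rw [← intervalIntegral.integral_finsetSum fun e _ => (hc _ _).intervalIntegrable _ _]
  have : ∀ s, ∑ e : Fin d → Fin 2, ∫ x in cornerCube (childCorner p ℓ e) (ℓ / 2), H s x ^ 2
      = ∫ x in cornerCube p ℓ, H s x ^ 2 := fun s =>
    sum_integral_children ((continuous_sq_uncurry hH).comp (Continuous.prodMk_right s)) p hℓ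
  simp only [this]
  exact intervalIntegral.integral_add_adjacent_intervals ((hc _ _).intervalIntegrable _ _)
    ((hc _ _).intervalIntegrable _ _)

/-- Jensen's inequality on `cube × [0, 1]`. -/
lemma sq_average_integral_le {k : ℝ → (Fin d → ℝ) → ℝ} (hk : Continuous k.uncurry)
    (p : Fin d → ℝ) {ℓ : ℝ} (hℓ : 0 < ℓ) :
    ((ℓ ^ d)⁻¹ * ∫ x in cornerCube p ℓ, ∫ t in (0 : ℝ)..1, k t x) ^ 2
      ≤ (ℓ ^ d)⁻¹ * ∫ t in (0 : ℝ)..1, ∫ x in cornerCube p ℓ, k t x ^ 2 := by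
  have hc : ∀ g : ℝ → (Fin d → ℝ) → ℝ, Continuous g.uncurry →
      Continuous fun x => ∫ t in (0 : ℝ)..1, g t x := fun g hg =>
    intervalIntegral.continuous_parametric_intervalIntegral_of_continuous'
      (f := fun x t => g t x) (hg.comp continuous_swap) 0 1
  have hk2 := continuous_sq_uncurry hk
  refine (sq_integral_cornerCube_le (hc k hk) p hℓ).trans ?_
  rw [← integral_cornerCube_swap hk2]
  refine mul_le_mul_of_nonneg_left ?_ (by positivity)
  exact setIntegral_mono (((hc k hk).pow 2).integrableOn_cornerCube p ℓ)
    ((hc _ hk2).integrableOn_cornerCube p ℓ)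
    fun x => sq_intervalIntegral_le (hk.comp (Continuous.prodMk_left x))

/-- If `|u|` is dominated by a multiple of `∫ k`, then the square of its mean is dominated by the
mean of `∫ k ^ 2`. -/
lemma sq_average_le_of_abs_le {u : (Fin d → ℝ) → ℝ} (hu : Continuous u)
    {k : ℝ → (Fin d → ℝ) → ℝ} (hk : Continuous k.uncurry) {A : ℝ} (p : Fin d → ℝ) {ℓ : ℝ}
    (hℓ : 0 < ℓ) (h : ∀ x ∈ cornerCube p ℓ, |u x| ≤ A * ∫ t in (0 : ℝ)..1, k t x) :
    ((ℓ ^ d)⁻¹ * ∫ x in cornerCube p ℓ, u x) ^ 2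
      ≤ A ^ 2 * ((ℓ ^ d)⁻¹ * ∫ t in (0 : ℝ)..1, ∫ x in cornerCube p ℓ, k t x ^ 2) := by
  have hc : Continuous fun x => ∫ t in (0 : ℝ)..1, k t x :=
    intervalIntegral.continuous_parametric_intervalIntegral_of_continuous'
      (f := fun x t => k t x) (hk.comp continuous_swap) 0 1
  have h1 : |∫ x in cornerCube p ℓ, u x|
      ≤ A * ∫ x in cornerCube p ℓ, ∫ t in (0 : ℝ)..1, k t x := by
    rw [← integral_const_mul]
    refine (abs_integral_le_integral_abs).trans ?_
    exact setIntegral_mono_on (hu.abs.integrableOn_cornerCube p ℓ)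
      ((hc.const_mul A).integrableOn_cornerCube p ℓ) (measurableSet_cornerCube p ℓ) h
  have h2 : |(ℓ ^ d)⁻¹ * ∫ x in cornerCube p ℓ, u x|
      ≤ A * ((ℓ ^ d)⁻¹ * ∫ x in cornerCube p ℓ, ∫ t in (0 : ℝ)..1, k t x) := by
    rw [abs_mul, abs_of_nonneg (by positivity : 0 ≤ (ℓ ^ d)⁻¹), mul_left_comm]
    exact mul_le_mul_of_nonneg_left h1 (by positivity)
  calc _ = |(ℓ ^ d)⁻¹ * ∫ x in cornerCube p ℓ, u x| ^ 2 := (sq_abs _).symm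
    _ ≤ (A * ((ℓ ^ d)⁻¹ * ∫ x in cornerCube p ℓ, ∫ t in (0 : ℝ)..1, k t x)) ^ 2 := by gcongr
    _ ≤ _ := by
      rw [mul_pow]
      exact mul_le_mul_of_nonneg_left (sq_average_integral_le hk p hℓ) (sq_nonneg _)

/-- The squared difference of the slice averages of a cube and of its child is controlled by the
energy in the upper half of the box over the cube. The dilation with factor `1 / 2` about the common vertex, at height zero,
takes the top face over the cube to the one over the child, and the segments that join
corresponding points sweep the upper half of the box only. -/
lemma sq_sliceAverage_child_sub_le (hG : Continuous G.uncurry) (hH : Continuous H.uncurry)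
    (hGH : HasSlopeBound M G H) (p : Fin d → ℝ) {ℓ : ℝ} (hℓ : 0 < ℓ) (e : Fin d → Fin 2) :
    ℓ ^ d / ℓ * (sliceAverage G (childCorner p ℓ e) (ℓ / 2) - sliceAverage G p ℓ) ^ 2
      ≤ M ^ 2 * 2 ^ d * slabEnergy H p ℓ (ℓ / 2) ℓ := by
  have he0 : ∀ i, (0 : ℝ) ≤ ((e i : ℕ) : ℝ) := fun i => by positivity
  have he1 : ∀ i, ((e i : ℕ) : ℝ) ≤ 1 := fun i => by exact_mod_cast Nat.lt_succ_iff.1 (e i).2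
  set q := commonVertex p ℓ e with hq
  -- the slice average over the child, pulled back to the parent cube
  have hchild : sliceAverage G (childCorner p ℓ e) (ℓ / 2)
      = (ℓ ^ d)⁻¹ * ∫ x in cornerCube p ℓ, G (ℓ / 2) ((1 / 2 : ℝ) • x + (1 / 2 : ℝ) • q) := by
    rw [integral_cornerCube_comp_affine (G (ℓ / 2)) p _ ℓ (by norm_num), sliceAverage]
    have h1 : (1 / 2 : ℝ) • p + (1 / 2 : ℝ) • q = childCorner p ℓ e := by
      ext i; simp only [hq, commonVertex, childCorner, Pi.add_apply, Pi.smul_apply, smul_eq_mul]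
      ring
    rw [h1, show (1 / 2 : ℝ) * ℓ = ℓ / 2 by ring, ← mul_assoc, ← mul_inv, ← mul_pow]
    congr 3
    ring
  let k : ℝ → (Fin d → ℝ) → ℝ := fun t x =>
    H (ℓ + t * (ℓ / 2 - ℓ)) (x + t • ((1 / 2 : ℝ) • x + (1 / 2 : ℝ) • q - x))
  have hk : Continuous k.uncurry := by
    refine hH.comp (f := fun z : ℝ × (Fin d → ℝ) => ((ℓ + z.1 * (ℓ / 2 - ℓ),
      z.2 + z.1 • ((1 / 2 : ℝ) • z.2 + (1 / 2 : ℝ) • q - z.2)) : ℝ × (Fin d → ℝ))) ?_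
    fun_prop
  have hGs : ∀ s, Continuous (G s) := fun s => hG.comp (Continuous.prodMk_right s)
  have hG2 : Continuous fun x => G (ℓ / 2) ((1 / 2 : ℝ) • x + (1 / 2 : ℝ) • q) :=
    (hGs _).comp (by fun_prop)
  have hdiff : sliceAverage G (childCorner p ℓ e) (ℓ / 2) - sliceAverage G p ℓ
      = (ℓ ^ d)⁻¹ * ∫ x in cornerCube p ℓ,
        (G (ℓ / 2) ((1 / 2 : ℝ) • x + (1 / 2 : ℝ) • q) - G ℓ x) := by
    rw [hchild, sliceAverage, ← mul_sub, integral_sub (hG2.integrableOn_cornerCube p ℓ)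
      ((hGs ℓ).integrableOn_cornerCube p ℓ)]
  have hsq := sq_average_le_of_abs_le (hG2.sub (hGs ℓ)) hk (A := M * (ℓ / 2)) p hℓ (by
    intro x hx
    rw [mem_cornerCube] at hx
    refine hGH ℓ (ℓ / 2) x _ (ℓ / 2) hℓ.le (by positivity) ?_ ?_
    · rw [abs_le]; constructor <;> linarith
    · intro i
      have := hx i
      have h0 := he0 i
      have h1 := he1 i
      simp only [hq, commonVertex, Pi.add_apply, Pi.smul_apply, smul_eq_mul]
      rw [abs_le]; constructor <;> nlinarith)
  have hinner : ∀ t ∈ Set.Icc (0 : ℝ) 1, ∫ x in cornerCube p ℓ, k t x ^ 2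
      ≤ 2 ^ d * ∫ x in cornerCube p ℓ, H (ℓ - ℓ / 2 * t) x ^ 2 := by
    rintro t ⟨ht0, ht1⟩
    have hτ : (0 : ℝ) < 1 - t / 2 := by linarith
    have heq : ∀ x, k t x ^ 2
        = (fun y => H (ℓ - ℓ / 2 * t) y ^ 2) ((1 - t / 2) • x + (t / 2) • q) := by
      intro x
      simp only [k]
      congr 2
      · ring
      · ext i; simp only [Pi.add_apply, Pi.smul_apply, Pi.sub_apply, smul_eq_mul]; ring
    have hcont : Continuous fun y => H (ℓ - ℓ / 2 * t) y ^ 2 :=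
      (continuous_sq_uncurry hH).comp (Continuous.prodMk_right _)
    have hpow : ((1 - t / 2) ^ d)⁻¹ ≤ (2 : ℝ) ^ d := by
      rw [← inv_pow]
      refine pow_le_pow_left₀ (by positivity) ?_ d
      rw [inv_le_comm₀ hτ (by norm_num)]
      linarith
    simp only [heq]
    refine (integral_cornerCube_comp_affine (fun y => H (ℓ - ℓ / 2 * t) y ^ 2) p ((t / 2) • q) ℓ
      hτ).trans_le ?_
    refine mul_le_mul hpow ?_ (integral_nonneg fun _ => sq_nonneg _) (by positivity)
    refine setIntegral_mono_set (hcont.integrableOn_cornerCube p ℓ)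
      (Filter.Eventually.of_forall fun _ => sq_nonneg _) (LE.le.eventuallyLE ?_)
    intro x hx
    rw [mem_cornerCube] at hx ⊢
    intro i
    have := hx i
    have h0 := he0 i
    have h1 := he1 i
    simp only [hq, commonVertex, Pi.add_apply, Pi.smul_apply, smul_eq_mul] at this
    have h2 : 0 ≤ t / 2 * ℓ * ((e i : ℕ) : ℝ) := by positivity
    have h3 : 0 ≤ t / 2 * ℓ * (1 - ((e i : ℕ) : ℝ)) :=
      mul_nonneg (by positivity) (by linarith)
    constructor <;> nlinarith
  have hcs := continuous_integral_sq hH p ℓ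
  have htotal : ∫ t in (0 : ℝ)..1, ∫ x in cornerCube p ℓ, k t x ^ 2
      ≤ 2 ^ d * ((ℓ / 2)⁻¹ * slabEnergy H p ℓ (ℓ / 2) ℓ) := by
    have h1 : ∫ t in (0 : ℝ)..1, 2 ^ d * ∫ x in cornerCube p ℓ, H (ℓ - ℓ / 2 * t) x ^ 2
        = 2 ^ d * ((ℓ / 2)⁻¹ * slabEnergy H p ℓ (ℓ / 2) ℓ) := by
      rw [intervalIntegral.integral_const_mul,
        intervalIntegral.integral_comp_sub_mul
          (fun s => ∫ x in cornerCube p ℓ, H s x ^ 2) (by positivity) ℓ, slabEnergy, smul_eq_mul]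
      simp only [mul_one, mul_zero, sub_zero, sub_half]
    rw [← h1]
    refine intervalIntegral.integral_mono_on zero_le_one ?_ ?_ hinner
    · exact (continuous_integral_sq hk p ℓ).intervalIntegrable _ _
    · exact (continuous_const.mul (hcs.comp (by fun_prop))).intervalIntegrable _ _
  rw [hdiff]
  have hE := slabEnergy_nonneg (H := H) p ℓ (show ℓ / 2 ≤ ℓ by linarith)
  calc _ ≤ ℓ ^ d / ℓ * ((M * (ℓ / 2)) ^ 2 *
        ((ℓ ^ d)⁻¹ * (2 ^ d * ((ℓ / 2)⁻¹ * slabEnergy H p ℓ (ℓ / 2) ℓ)))) := by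
        gcongr
        exact hsq.trans (by gcongr)
    _ = M ^ 2 * 2 ^ d * slabEnergy H p ℓ (ℓ / 2) ℓ / 2 := by field_simp
    _ ≤ _ := half_le_self (by positivity)

/-- The squared difference of the slice average at height `ℓ` and the mean at height zero is
controlled by the energy in the box; the segments used here are vertical. -/
lemma sq_sliceAverage_sub_boundary_le (hG : Continuous G.uncurry) (hH : Continuous H.uncurry)
    (hGH : HasSlopeBound M G H) (p : Fin d → ℝ) {ℓ : ℝ} (hℓ : 0 < ℓ) :
    ℓ ^ d / ℓ * (sliceAverage G p ℓ - (ℓ ^ d)⁻¹ * ∫ x in cornerCube p ℓ, G 0 x) ^ 2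
      ≤ M ^ 2 * slabEnergy H p ℓ 0 ℓ := by
  have hGs : ∀ s, Continuous (G s) := fun s => hG.comp (Continuous.prodMk_right s)
  have hk : Continuous (Function.uncurry fun (t : ℝ) (x : Fin d → ℝ) => H (ℓ * t) x) :=
    hH.comp (f := fun z : ℝ × (Fin d → ℝ) => ((ℓ * z.1, z.2) : ℝ × (Fin d → ℝ))) (by fun_prop)
  have hsq := sq_average_le_of_abs_le ((hGs ℓ).sub (hGs 0)) hk (A := M * ℓ) p hℓ (by
    intro x hx
    have h := hGH 0 ℓ x x ℓ le_rfl hℓ.le (by rw [sub_zero, abs_of_pos hℓ]) (by simp [hℓ.le])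
    simpa [mul_comm] using h)
  rw [sliceAverage, ← mul_sub, ← integral_sub ((hGs ℓ).integrableOn_cornerCube p ℓ)
    ((hGs 0).integrableOn_cornerCube p ℓ)]
  have h1 : ∫ t in (0 : ℝ)..1, ∫ x in cornerCube p ℓ, H (ℓ * t) x ^ 2
      = ℓ⁻¹ * slabEnergy H p ℓ 0 ℓ := by
    rw [intervalIntegral.integral_comp_mul_left
      (fun s => ∫ x in cornerCube p ℓ, H s x ^ 2) hℓ.ne', slabEnergy]
    simp
  rw [h1] at hsq
  calc _ ≤ ℓ ^ d / ℓ * ((M * ℓ) ^ 2 * ((ℓ ^ d)⁻¹ * (ℓ⁻¹ * slabEnergy H p ℓ 0 ℓ))) := by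
        gcongr
        exact hsq
    _ = M ^ 2 * slabEnergy H p ℓ 0 ℓ := by field_simp

/-- On small cubes, the slice average is close to the boundary values. -/
lemma exists_sq_le_sliceAverage_sq_add (hG : Continuous G.uncurry) (p : Fin d → ℝ) {ℓ : ℝ}
    (hℓ : 0 < ℓ) {τ : ℝ} (hτ : 0 < τ) :
    ∃ K : ℕ, ∀ p' : Fin d → ℝ, cornerCube p' (ℓ / 2 ^ K) ⊆ cornerCube p ℓ →
      ∀ x ∈ cornerCube p' (ℓ / 2 ^ K),
        G 0 x ^ 2 ≤ sliceAverage G p' (ℓ / 2 ^ K) ^ 2 + τ := by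
  have hcomp : IsCompact (Set.Icc (0 : ℝ) ℓ ×ˢ cornerCube p ℓ) :=
    isCompact_Icc.prod (isCompact_cornerCube p ℓ)
  obtain ⟨B, hB⟩ := hcomp.exists_bound_of_continuousOn hG.continuousOn
  have hB0 : 0 ≤ |B| := abs_nonneg B
  obtain ⟨η, hη, hη1, hητ⟩ : ∃ η : ℝ, 0 < η ∧ η ≤ 1 ∧ η * (2 * |B| + 1) ≤ τ := by
    refine ⟨min 1 (τ / (2 * |B| + 1)), by positivity, min_le_left _ _, ?_⟩
    exact (mul_le_mul_of_nonneg_right (min_le_right _ _) (by positivity)).trans_eq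
      (div_mul_cancel₀ _ (by positivity))
  obtain ⟨δ, hδ, hδη⟩ := Metric.uniformContinuousOn_iff_le.1
    (hcomp.uniformContinuousOn_of_continuous hG.continuousOn) η hη
  obtain ⟨K, hK⟩ := exists_pow_lt_of_lt_one (div_pos hδ hℓ) (by norm_num : (1 / 2 : ℝ) < 1)
  refine ⟨K, fun p' hp' x hx => ?_⟩
  set r := ℓ / 2 ^ K with hr
  have hr0 : 0 < r := by positivity
  have hrδ : r ≤ δ := by
    rw [lt_div_iff₀ hℓ, one_div, inv_pow] at hK
    rw [hr, div_eq_inv_mul]; exact hK.le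
  have hrℓ : r ≤ ℓ := div_le_self hℓ.le (one_le_pow₀ (by norm_num))
  have hGs : ∀ s, Continuous (G s) := fun s => hG.comp (Continuous.prodMk_right s)
  have hclose : ∀ y ∈ cornerCube p' r, ‖G r y - G 0 x‖ ≤ η := by
    intro y hy
    have h := hδη (r, y) ⟨⟨hr0.le, hrℓ⟩, hp' hy⟩ (0, x) ⟨⟨le_rfl, hℓ.le⟩, hp' hx⟩ (by
      rw [Prod.dist_eq]
      refine max_le ?_ ?_
      · simpa [abs_of_pos hr0] using hrδ
      · refine (dist_pi_le_iff hδ.le).2 fun i => ?_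
        rw [mem_cornerCube] at hx hy
        have := hx i
        have := hy i
        rw [Real.dist_eq, abs_le]; constructor <;> linarith)
    simpa [Real.dist_eq] using h
  have havg : |sliceAverage G p' r - G 0 x| ≤ η := by
    have hv := volume_real_cornerCube p' hr0.le
    have h1 : sliceAverage G p' r - G 0 x
        = (r ^ d)⁻¹ * ∫ y in cornerCube p' r, (G r y - G 0 x) := by
      rw [integral_sub ((hGs r).integrableOn_cornerCube p' r)
        (continuous_const.integrableOn_cornerCube p' r), setIntegral_const, hv, sliceAverage,
        smul_eq_mul]
      field_simp
    have h2 := norm_setIntegral_le_of_norm_le_const (μ := volume)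
      (isCompact_cornerCube p' r).measure_lt_top hclose
    rw [h1, abs_mul, abs_of_pos (by positivity : 0 < (r ^ d)⁻¹), inv_mul_le_iff₀ (by positivity),
      mul_comm, ← hv]
    exact h2
  have hx0 : |G 0 x| ≤ |B| :=
    (hB (0, x) ⟨⟨le_rfl, hℓ.le⟩, hp' hx⟩).trans (le_abs_self B)
  rw [abs_le] at havg hx0
  obtain ⟨h1, h2⟩ := havg
  obtain ⟨h3, h4⟩ := hx0
  have hlin : 2 * G 0 x * (sliceAverage G p' r - G 0 x) ≥ -(2 * |B| * η) := by
    have := abs_mul (G 0 x) (sliceAverage G p' r - G 0 x)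
    have h5 : |G 0 x| * |sliceAverage G p' r - G 0 x| ≤ |B| * η :=
      mul_le_mul (abs_le.2 ⟨h3, h4⟩) (abs_le.2 ⟨h1, h2⟩) (abs_nonneg _) hB0
    have := neg_abs_le (G 0 x * (sliceAverage G p' r - G 0 x))
    nlinarith
  nlinarith [sq_nonneg (sliceAverage G p' r - G 0 x)]

end Slices

/-! ### The Bellman function -/

/-- The potential `ℓ ^ (s - 1) * ∫ V ^ s` of the cube with corner `p` and side `ℓ`. In contrast to
`∫ V`, it loses a fixed factor when it is summed over the children of a cube. -/
noncomputable def morreyPotential {d : ℕ} (s : ℝ) (V : (Fin d → ℝ) → ℝ) (p : Fin d → ℝ)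
    (ℓ : ℝ) : ℝ :=
  ℓ ^ (s - 1) * ∫ x in cornerCube p ℓ, V x ^ s

section Bellman

variable {d : ℕ} {V : (Fin d → ℝ) → ℝ} {s : ℝ}

lemma morreyPotential_nonneg (hV0 : ∀ x, 0 ≤ V x) (p : Fin d → ℝ) {ℓ : ℝ} (hℓ : 0 < ℓ) :
    0 ≤ morreyPotential s V p ℓ :=
  mul_nonneg (by positivity) (integral_nonneg fun x => Real.rpow_nonneg (hV0 x) _)

lemma sum_morreyPotential_children (hV : Continuous V) (hs : 1 ≤ s) (p : Fin d → ℝ) {ℓ : ℝ}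
    (hℓ : 0 < ℓ) :
    ∑ e : Fin d → Fin 2, morreyPotential s V (childCorner p ℓ e) (ℓ / 2)
      = (1 / 2) ^ (s - 1) * morreyPotential s V p ℓ := by
  unfold morreyPotential
  rw [← Finset.mul_sum, sum_integral_children (hV.rpow_const fun x => Or.inr (by linarith)) p hℓ,
    ← mul_assoc, ← Real.mul_rpow (by norm_num) hℓ.le]
  congr 2
  ring

lemma morreyPotential_le (p : Fin d → ℝ) {ℓ : ℝ} (hℓ : 0 < ℓ)
    (h : ℓ ^ s * ((ℓ ^ d)⁻¹ * ∫ x in cornerCube p ℓ, V x ^ s) ≤ 1) :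
    morreyPotential s V p ℓ ≤ ℓ ^ d / ℓ := by
  have hL : 0 < ℓ ^ d / ℓ := by positivity
  calc morreyPotential s V p ℓ
      = ℓ ^ d / ℓ * (ℓ ^ s * ((ℓ ^ d)⁻¹ * ∫ x in cornerCube p ℓ, V x ^ s)) := by
        rw [morreyPotential, Real.rpow_sub_one hℓ.ne']
        field_simp
    _ ≤ _ := mul_le_of_le_one_right hL.le h

/-- By Jensen's inequality, `v = ℓ * ⨍ V` satisfies `v ^ s ≤ ℓ ^ s * ⨍ V ^ s ≤ 1`, so that
`v ^ 2 ≤ v ^ s` for `s ≤ 2`. -/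
lemma sq_integral_le_mul_morreyPotential (hV : Continuous V) (hV0 : ∀ x, 0 ≤ V x) (hs : 1 ≤ s)
    (hs2 : s ≤ 2) (p : Fin d → ℝ) {ℓ : ℝ} (hℓ : 0 < ℓ)
    (h : ℓ ^ s * ((ℓ ^ d)⁻¹ * ∫ x in cornerCube p ℓ, V x ^ s) ≤ 1) :
    (∫ x in cornerCube p ℓ, V x) ^ 2 ≤ ℓ ^ d / ℓ * morreyPotential s V p ℓ := by
  have hI : 0 ≤ ∫ x in cornerCube p ℓ, V x := integral_nonneg hV0
  set v := ℓ * ((ℓ ^ d)⁻¹ * ∫ x in cornerCube p ℓ, V x) with hv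
  have hv0 : 0 ≤ v := by positivity
  have hvs : v ^ s ≤ ℓ ^ s * ((ℓ ^ d)⁻¹ * ∫ x in cornerCube p ℓ, V x ^ s) := by
    rw [hv, Real.mul_rpow hℓ.le (by positivity)]
    exact mul_le_mul_of_nonneg_left (rpow_average_le hV hV0 hs p hℓ) (by positivity)
  have hv1 : v ≤ 1 := by
    by_contra! hlt
    exact absurd (hvs.trans h) (not_le.2 (Real.one_lt_rpow hlt (by linarith)))
  have hv2 : v ^ 2 ≤ v ^ s := by
    rw [← Real.rpow_two]
    exact Real.rpow_le_rpow_of_exponent_ge_of_imp hv0 hv1 hs2 (fun _ h => by linarith)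
  calc (∫ x in cornerCube p ℓ, V x) ^ 2 = (ℓ ^ d / ℓ) ^ 2 * v ^ 2 := by rw [hv]; field_simp
    _ ≤ (ℓ ^ d / ℓ) ^ 2 * (ℓ ^ s * ((ℓ ^ d)⁻¹ * ∫ x in cornerCube p ℓ, V x ^ s)) :=
      mul_le_mul_of_nonneg_left (hv2.trans hvs) (by positivity)
    _ = _ := by
      rw [morreyPotential, Real.rpow_sub_one hℓ.ne']
      field_simp

/-- The step of the induction, for one cube: `m + φ` is the Bellman coefficient of the cube,
`ψ e` that of its child `e`, `c` and `c' e` are the averages, and `b` bounds `L * (c' e - c) ^ 2`.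
The surplus `κ * φ * c ^ 2` absorbs the cross terms. -/
lemma bellman_step {ι : Type*} [Fintype ι] {ψ c' : ι → ℝ} {m φ κ L c b : ℝ}
    (hψ : ∀ e, 0 ≤ ψ e) (hm : 0 ≤ m) (hφ : 0 ≤ φ) (hκ : 0 < κ) (hL : 0 < L)
    (hsum : ∑ e, ψ e = m + φ - κ * φ) (hφL : φ ≤ L) (hmφ : m ^ 2 ≤ L * φ)
    (hc : ∀ e, L * (c' e - c) ^ 2 ≤ b) (hb : 0 ≤ b) :
    ∑ e, ψ e * c' e ^ 2 ≤ (m + φ) * c ^ 2 + (4 / κ + 2) * b := by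
  set a := Real.sqrt (b / L) with ha
  have ha0 : 0 ≤ a := Real.sqrt_nonneg _
  have ha2 : L * a ^ 2 = b := by
    rw [ha, Real.sq_sqrt (by positivity)]; field_simp
  have hca : ∀ e, |c' e - c| ≤ a := fun e => by
    apply Real.abs_le_sqrt
    rw [le_div_iff₀ hL, mul_comm]
    exact hc e
  have hc2 : ∀ e, c' e ^ 2 ≤ c ^ 2 + (2 * |c| * a + a ^ 2) := fun e => by
    have h1 : |c' e| ≤ |c| + a := by
      have := abs_add_le c (c' e - c)
      rw [add_sub_cancel] at this
      linarith [hca e]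
    have h2 := pow_le_pow_left₀ (abs_nonneg _) h1 2
    rw [sq_abs] at h2
    nlinarith [sq_abs c]
  have hmL : m ≤ L := by nlinarith
  -- `(m + φ) ^ 2 ≤ 4 * L * φ`, so that the cross term can be absorbed
  have hsq : (m + φ) ^ 2 ≤ 4 * L * φ := by nlinarith [sq_nonneg (m - φ)]
  have hcross : 2 * |c| * a * (m + φ) ≤ κ * φ * c ^ 2 + 4 / κ * b := by
    have h1 : 2 * |c| * a * (m + φ)
        ≤ 2 * ((Real.sqrt (κ * φ) * |c|) * (Real.sqrt (4 / κ * L) * a)) := by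
      have h2 : m + φ ≤ Real.sqrt (κ * φ) * Real.sqrt (4 / κ * L) := by
        rw [← Real.sqrt_mul (by positivity)]
        apply Real.le_sqrt_of_sq_le
        rw [show κ * φ * (4 / κ * L) = 4 * L * φ by field_simp]
        exact hsq
      nlinarith [mul_le_mul_of_nonneg_left h2 (mul_nonneg (abs_nonneg c) ha0)]
    have h3 := two_mul_le_add_sq (Real.sqrt (κ * φ) * |c|) (Real.sqrt (4 / κ * L) * a)
    rw [mul_pow, mul_pow, Real.sq_sqrt (by positivity), Real.sq_sqrt (by positivity), sq_abs,
      mul_assoc (4 / κ), ha2] at h3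
    linarith
  have hab : 0 ≤ 2 * |c| * a + a ^ 2 := by positivity
  calc ∑ e, ψ e * c' e ^ 2 ≤ ∑ e, ψ e * (c ^ 2 + (2 * |c| * a + a ^ 2)) :=
        Finset.sum_le_sum fun e _ => mul_le_mul_of_nonneg_left (hc2 e) (hψ e)
    _ = (m + φ - κ * φ) * (c ^ 2 + (2 * |c| * a + a ^ 2)) := by rw [← Finset.sum_mul, hsum]
    _ ≤ (m + φ) * c ^ 2 + (4 / κ + 2) * b := by
      have h4 : (m + φ) * a ^ 2 ≤ 2 * b := by rw [← ha2]; nlinarith [sq_nonneg a]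
      have h5 : 0 ≤ κ * φ * (2 * |c| * a + a ^ 2) := by positivity
      nlinarith

variable {G H : ℝ → (Fin d → ℝ) → ℝ} {M : ℝ}

/-- The Bellman induction on the number of generations between a cube and the scale at which the
boundary values are replaced by slice averages. -/
lemma integral_mul_sq_le_of_generation (hV : Continuous V) (hV0 : ∀ x, 0 ≤ V x) (hs : 1 < s)
    (hs2 : s ≤ 2) (hG : Continuous G.uncurry) (hH : Continuous H.uncurry)
    (hGH : HasSlopeBound M G H) {D : (Fin d → ℝ) → ℝ → Prop} (hD0 : ∀ p ℓ, D p ℓ → 0 < ℓ)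
    (hDchild : ∀ p ℓ, D p ℓ → ∀ e, D (childCorner p ℓ e) (ℓ / 2))
    (hDV : ∀ p ℓ, D p ℓ → ℓ ^ s * ((ℓ ^ d)⁻¹ * ∫ x in cornerCube p ℓ, V x ^ s) ≤ 1)
    {τ : ℝ} (K : ℕ) : ∀ (p : Fin d → ℝ) (ℓ : ℝ), D p ℓ →
      (∀ p' : Fin d → ℝ, cornerCube p' (ℓ / 2 ^ K) ⊆ cornerCube p ℓ →
        ∀ x ∈ cornerCube p' (ℓ / 2 ^ K), G 0 x ^ 2 ≤ sliceAverage G p' (ℓ / 2 ^ K) ^ 2 + τ) →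
      ∫ x in cornerCube p ℓ, V x * G 0 x ^ 2
        ≤ ((∫ x in cornerCube p ℓ, V x) + morreyPotential s V p ℓ) * sliceAverage G p ℓ ^ 2
          + (4 / (1 - (1 / 2 : ℝ) ^ (s - 1)) + 2) * (M ^ 2 * 2 ^ d) * slabEnergy H p ℓ 0 ℓ
          + τ * ∫ x in cornerCube p ℓ, V x := by
  have hκ : 0 < 1 - (1 / 2 : ℝ) ^ (s - 1) :=
    sub_pos.2 (Real.rpow_lt_one (by norm_num) (by norm_num) (by linarith))
  have hG0 : Continuous (G 0) := hG.comp (Continuous.prodMk_right 0)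
  have hVG : Continuous fun x => V x * G 0 x ^ 2 := hV.mul (hG0.pow 2)
  induction K with
  | zero =>
    intro p ℓ hD hK
    have hℓ := hD0 p ℓ hD
    simp only [pow_zero, div_one] at hK
    have hmain : ∫ x in cornerCube p ℓ, V x * G 0 x ^ 2
        ≤ ∫ x in cornerCube p ℓ, V x * (sliceAverage G p ℓ ^ 2 + τ) :=
      setIntegral_mono_on (hVG.integrableOn_cornerCube p ℓ)
        ((hV.mul continuous_const).integrableOn_cornerCube p ℓ) (measurableSet_cornerCube p ℓ)
        fun x hx => mul_le_mul_of_nonneg_left (hK p le_rfl x hx) (hV0 x)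
    rw [integral_mul_const] at hmain
    have h1 := mul_nonneg (morreyPotential_nonneg (s := s) hV0 p hℓ)
      (sq_nonneg (sliceAverage G p ℓ))
    have h2 : 0 ≤ (4 / (1 - (1 / 2 : ℝ) ^ (s - 1)) + 2) * (M ^ 2 * 2 ^ d)
        * slabEnergy H p ℓ 0 ℓ := by
      have := slabEnergy_nonneg (H := H) p ℓ hℓ.le
      positivity
    nlinarith
  | succ K ih =>
    intro p ℓ hD hK
    have hℓ := hD0 p ℓ hD
    set B := 4 / (1 - (1 / 2 : ℝ) ^ (s - 1)) + 2 with hB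
    set A := M ^ 2 * (2 : ℝ) ^ d with hA
    have hchild : ∀ e : Fin d → Fin 2, _ := fun e =>
      ih (childCorner p ℓ e) (ℓ / 2) (hDchild p ℓ hD e) (by
      have hpow : ℓ / 2 / 2 ^ K = ℓ / 2 ^ (K + 1) := by rw [pow_succ']; field_simp
      rw [hpow]
      exact fun p' hp' => hK p' (hp'.trans (childCorner_cube_subset hℓ.le e)))
    have hsumm := Finset.sum_le_sum fun e (_ : e ∈ Finset.univ) => hchild e
    rw [sum_integral_children hVG p hℓ, Finset.sum_add_distrib, Finset.sum_add_distrib,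
      ← Finset.mul_sum, ← Finset.mul_sum, sum_integral_children hV p hℓ] at hsumm
    have hslab := slabEnergy_split hH p hℓ
    have hstep := bellman_step
      (ψ := fun e => (∫ x in cornerCube (childCorner p ℓ e) (ℓ / 2), V x)
        + morreyPotential s V (childCorner p ℓ e) (ℓ / 2))
      (c' := fun e => sliceAverage G (childCorner p ℓ e) (ℓ / 2))
      (m := ∫ x in cornerCube p ℓ, V x) (φ := morreyPotential s V p ℓ)
      (κ := 1 - (1 / 2 : ℝ) ^ (s - 1)) (L := ℓ ^ d / ℓ) (c := sliceAverage G p ℓ)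
      (b := A * slabEnergy H p ℓ (ℓ / 2) ℓ)
      (fun e => add_nonneg (integral_nonneg hV0) (morreyPotential_nonneg hV0 _ (half_pos hℓ)))
      (integral_nonneg hV0) (morreyPotential_nonneg hV0 _ hℓ) hκ (by positivity)
      (by
        rw [Finset.sum_add_distrib, sum_integral_children hV p hℓ,
          sum_morreyPotential_children hV hs.le p hℓ]
        ring)
      (morreyPotential_le p hℓ (hDV p ℓ hD))
      (sq_integral_le_mul_morreyPotential hV hV0 hs.le hs2 p hℓ (hDV p ℓ hD))
      (fun e => sq_sliceAverage_child_sub_le hG hH hGH p hℓ e)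
      (mul_nonneg (by positivity) (slabEnergy_nonneg p ℓ (by linarith)))
    rw [← hB] at hstep
    rw [← hslab]
    linarith

/-- The trace inequality on a box, for a weight whose `s`-averages over the dyadic descendants of
the base are controlled. -/
theorem integral_mul_sq_le_slabEnergy (hV : Continuous V) (hV0 : ∀ x, 0 ≤ V x) (hs : 1 < s)
    (hs2 : s ≤ 2) (hG : Continuous G.uncurry) (hH : Continuous H.uncurry)
    (hGH : HasSlopeBound M G H) {D : (Fin d → ℝ) → ℝ → Prop} (hD0 : ∀ p ℓ, D p ℓ → 0 < ℓ)
    (hDchild : ∀ p ℓ, D p ℓ → ∀ e, D (childCorner p ℓ e) (ℓ / 2))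
    (hDV : ∀ p ℓ, D p ℓ → ℓ ^ s * ((ℓ ^ d)⁻¹ * ∫ x in cornerCube p ℓ, V x ^ s) ≤ 1)
    (p : Fin d → ℝ) (ℓ : ℝ) (hD : D p ℓ) :
    ∫ x in cornerCube p ℓ, V x * G 0 x ^ 2
      ≤ ((4 / (1 - (1 / 2 : ℝ) ^ (s - 1)) + 2) * (M ^ 2 * 2 ^ d) + 4 * M ^ 2)
          * slabEnergy H p ℓ 0 ℓ + 4 * ℓ⁻¹ * ∫ x in cornerCube p ℓ, G 0 x ^ 2 := by
  have hℓ := hD0 p ℓ hD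
  have hG0 : Continuous (G 0) := hG.comp (Continuous.prodMk_right 0)
  set L := ℓ ^ d / ℓ with hL
  have hL0 : 0 < L := by positivity
  set c := sliceAverage G p ℓ
  set f := (ℓ ^ d)⁻¹ * ∫ x in cornerCube p ℓ, G 0 x with hf
  have hφ := morreyPotential_le p hℓ (hDV p ℓ hD)
  have hφ0 := morreyPotential_nonneg (s := s) hV0 p hℓ
  have hm0 : 0 ≤ ∫ x in cornerCube p ℓ, V x := integral_nonneg hV0
  have hm := sq_integral_le_mul_morreyPotential hV hV0 hs.le hs2 p hℓ (hDV p ℓ hD)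
  have hmL : ∫ x in cornerCube p ℓ, V x ≤ L := by nlinarith
  have hlim : ∫ x in cornerCube p ℓ, V x * G 0 x ^ 2
      ≤ ((∫ x in cornerCube p ℓ, V x) + morreyPotential s V p ℓ) * c ^ 2
          + (4 / (1 - (1 / 2 : ℝ) ^ (s - 1)) + 2) * (M ^ 2 * 2 ^ d) * slabEnergy H p ℓ 0 ℓ := by
    refine le_of_forall_pos_le_add fun ε hε => ?_
    obtain ⟨K, hK⟩ := exists_sq_le_sliceAverage_sq_add hG p hℓ (div_pos hε hL0)
    have h := integral_mul_sq_le_of_generation hV hV0 hs hs2 hG hH hGH hD0 hDchild hDV K p ℓ hD hK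
    have h' : ε / L * ∫ x in cornerCube p ℓ, V x ≤ ε :=
      (mul_le_mul_of_nonneg_left hmL (by positivity)).trans_eq (div_mul_cancel₀ _ hL0.ne')
    linarith
  have htop : L * (c - f) ^ 2 ≤ M ^ 2 * slabEnergy H p ℓ 0 ℓ :=
    sq_sliceAverage_sub_boundary_le hG hH hGH p hℓ
  have hbdry : L * f ^ 2 ≤ ℓ⁻¹ * ∫ x in cornerCube p ℓ, G 0 x ^ 2 := by
    calc L * f ^ 2 ≤ L * ((ℓ ^ d)⁻¹ * ∫ x in cornerCube p ℓ, G 0 x ^ 2) :=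
          mul_le_mul_of_nonneg_left (sq_integral_cornerCube_le hG0 p hℓ) hL0.le
      _ = _ := by rw [hL]; field_simp
  have hc : L * c ^ 2 ≤ 2 * (L * (c - f) ^ 2) + 2 * (L * f ^ 2) := by
    nlinarith [mul_nonneg hL0.le (sq_nonneg (c - 2 * f))]
  have hΨ : ((∫ x in cornerCube p ℓ, V x) + morreyPotential s V p ℓ) * c ^ 2
      ≤ 2 * (L * c ^ 2) := by
    nlinarith [sq_nonneg c]
  linarith

end Bellman

/-! ### The half-space in product coordinates -/

/-- The point of `ℝ^(d+1)` over `x` at height `s`. -/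
noncomputable def heightPoint {d : ℕ} (s : ℝ) (x : Fin d → ℝ) : EuclideanSpace ℝ (Fin (d + 1)) :=
  WithLp.toLp 2 (Fin.snoc (α := fun _ => ℝ) x s)

/-- The function `F` in product coordinates on `ℝ × ℝ^d`, extended from the half-space by the value
at height zero. The extension keeps the continuity that holds on the half-space. -/
noncomputable def onHalfSpace {d : ℕ} {α : Type*} (F : EuclideanSpace ℝ (Fin (d + 1)) → α) (s : ℝ)
    (x : Fin d → ℝ) : α :=
  F (heightPoint (max s 0) x)

section HalfSpace

variable {d : ℕ}

@[simp] lemma heightPoint_last (s : ℝ) (x : Fin d → ℝ) : heightPoint s x (Fin.last d) = s := by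
  simp [heightPoint]

@[simp] lemma heightPoint_castSucc (s : ℝ) (x : Fin d → ℝ) (i : Fin d) :
    heightPoint s x i.castSucc = x i := by
  simp [heightPoint]

lemma continuous_heightPoint :
    Continuous fun z : ℝ × (Fin d → ℝ) => heightPoint z.1 z.2 := by
  refine (PiLp.continuous_toLp 2 _).comp (continuous_pi fun i => ?_)
  refine Fin.lastCases ?_ (fun i => ?_) i
  · simpa using continuous_fst
  · simp only [Fin.snoc_castSucc]
    fun_prop

lemma heightPoint_lineMap (s₀ s₁ t : ℝ) (x₀ x₁ : Fin d → ℝ) :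
    heightPoint (s₀ + t * (s₁ - s₀)) (x₀ + t • (x₁ - x₀))
      = AffineMap.lineMap (heightPoint s₀ x₀) (heightPoint s₁ x₁) t := by
  ext i
  refine Fin.lastCases ?_ (fun i => ?_) i
  · simp [AffineMap.lineMap_apply_module']; ring
  · simp [AffineMap.lineMap_apply_module']; ring

lemma norm_heightPoint_sub_le {s₀ s₁ r : ℝ} {x₀ x₁ : Fin d → ℝ} (hs : |s₁ - s₀| ≤ r)
    (hx : ∀ i, |x₁ i - x₀ i| ≤ r) :
    ‖heightPoint s₁ x₁ - heightPoint s₀ x₀‖ ≤ √(d + 1 : ℝ) * r := by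
  have hr : 0 ≤ r := (abs_nonneg _).trans hs
  rw [EuclideanSpace.norm_eq, ← Real.sqrt_sq hr, ← Real.sqrt_mul (by positivity)]
  apply Real.sqrt_le_sqrt
  have h : ∀ i, ‖(heightPoint s₁ x₁ - heightPoint s₀ x₀) i‖ ^ 2 ≤ r ^ 2 := by
    intro i
    refine pow_le_pow_left₀ (norm_nonneg _) ?_ 2
    refine Fin.lastCases ?_ (fun i => ?_) i
    · simpa using hs
    · simpa using hx i
  calc _ ≤ ∑ _i : Fin (d + 1), r ^ 2 := Finset.sum_le_sum fun i _ => h i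
    _ = _ := by simp

lemma heightPoint_mem_halfSpace {s : ℝ} (hs : 0 ≤ s) (x : Fin d → ℝ) :
    heightPoint s x ∈ halfSpace d := by
  simpa [halfSpace] using hs

lemma boundaryPoint_toLp (x : Fin d → ℝ) : boundaryPoint (WithLp.toLp 2 x) = heightPoint 0 x :=
  rfl

lemma convex_halfSpace : Convex ℝ (halfSpace d) := by
  intro x hx y hy a b ha hb _
  have hx' : 0 ≤ x (Fin.last d) := hx
  have hy' : 0 ≤ y (Fin.last d) := hy
  change 0 ≤ (a • x + b • y) (Fin.last d)
  simp only [PiLp.add_apply, PiLp.smul_apply, smul_eq_mul]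
  positivity

lemma uniqueDiffOn_halfSpace : UniqueDiffOn ℝ (halfSpace d) := by
  refine uniqueDiffOn_convex convex_halfSpace ⟨heightPoint 1 0, ?_⟩
  rw [mem_interior]
  refine ⟨{x | 0 < x (Fin.last d)}, fun x (hx : 0 < x (Fin.last d)) => hx.le, ?_, by simp⟩
  exact isOpen_lt continuous_const (by fun_prop)

lemma continuous_onHalfSpace {α : Type*} [TopologicalSpace α]
    {F : EuclideanSpace ℝ (Fin (d + 1)) → α} (hF : ContinuousOn F (halfSpace d)) :
    Continuous (onHalfSpace F).uncurry := by
  refine hF.comp_continuous (continuous_heightPoint.comp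
    (f := fun z : ℝ × (Fin d → ℝ) => ((max z.1 0, z.2) : ℝ × (Fin d → ℝ))) (by fun_prop)) ?_
  exact fun z => heightPoint_mem_halfSpace (le_max_right _ _) _

lemma norm_gradientWithin {E : Type*} [NormedAddCommGroup E] [InnerProductSpace ℝ E]
    [CompleteSpace E] (F : E → ℝ) (s : Set E) (x : E) :
    ‖gradientWithin F s x‖ = ‖fderivWithin ℝ F s x‖ := by
  simp [gradientWithin]

lemma continuousOn_norm_gradientWithin {F : EuclideanSpace ℝ (Fin (d + 1)) → ℝ}
    (hF : ContDiffOn ℝ ∞ F (halfSpace d)) :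
    ContinuousOn (fun y => ‖gradientWithin F (halfSpace d) y‖) (halfSpace d) := by
  simp only [norm_gradientWithin]
  exact (hF.continuousOn_fderivWithin uniqueDiffOn_halfSpace (by simp)).norm

/-- The fundamental theorem of calculus along a segment in a convex set. -/
lemma abs_sub_le_norm_mul_integral_gradientWithin {E : Type*} [NormedAddCommGroup E]
    [InnerProductSpace ℝ E] [CompleteSpace E] {F : E → ℝ} {S : Set E} (hS : Convex ℝ S)
    (hF : DifferentiableOn ℝ F S) (hF' : ContinuousOn (fderivWithin ℝ F S) S) {y₀ y₁ : E}
    (h₀ : y₀ ∈ S) (h₁ : y₁ ∈ S) :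
    |F y₁ - F y₀|
      ≤ ‖y₁ - y₀‖ * ∫ t in (0 : ℝ)..1, ‖gradientWithin F S (AffineMap.lineMap y₀ y₁ t)‖ := by
  have hmem : ∀ t ∈ Set.Icc (0 : ℝ) 1, AffineMap.lineMap y₀ y₁ t ∈ S :=
    fun t ht => hS.lineMap_mem h₀ h₁ ht
  have hline : Continuous fun t : ℝ => (AffineMap.lineMap y₀ y₁ t : E) :=
    AffineMap.lineMap_continuous
  have hcF' : ContinuousOn (fun t : ℝ => fderivWithin ℝ F S (AffineMap.lineMap y₀ y₁ t))
      (Set.Icc 0 1) := hF'.comp hline.continuousOn hmem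
  have hcont' : ContinuousOn (fun t : ℝ =>
      fderivWithin ℝ F S (AffineMap.lineMap y₀ y₁ t) (y₁ - y₀)) (Set.uIcc 0 1) := by
    rw [Set.uIcc_of_le zero_le_one]
    exact hcF'.clm_apply continuousOn_const
  have hftc := intervalIntegral.integral_eq_sub_of_hasDeriv_right (a := 0) (b := 1)
    (f := fun t : ℝ => F (AffineMap.lineMap y₀ y₁ t))
    (f' := fun t : ℝ => fderivWithin ℝ F S (AffineMap.lineMap y₀ y₁ t) (y₁ - y₀)) (by
      rw [Set.uIcc_of_le zero_le_one]
      exact hF.continuousOn.comp hline.continuousOn hmem) (by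
      intro t ht
      rw [min_eq_left zero_le_one, max_eq_right zero_le_one] at ht
      have h1 : HasDerivWithinAt (fun t : ℝ => F (AffineMap.lineMap y₀ y₁ t))
          (fderivWithin ℝ F S (AffineMap.lineMap y₀ y₁ t) (y₁ - y₀)) (Set.Icc 0 1) t :=
        (hF _ (hmem t ⟨ht.1.le, ht.2.le⟩)).hasFDerivWithinAt.comp_hasDerivWithinAt t
          AffineMap.hasDerivWithinAt_lineMap hmem
      exact (h1.hasDerivAt (Icc_mem_nhds ht.1 ht.2)).hasDerivWithinAt)
    hcont'.intervalIntegrable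
  simp only [AffineMap.lineMap_apply_one, AffineMap.lineMap_apply_zero] at hftc
  rw [← hftc, ← intervalIntegral.integral_const_mul]
  refine (intervalIntegral.abs_integral_le_integral_abs zero_le_one).trans ?_
  refine intervalIntegral.integral_mono_on zero_le_one hcont'.abs.intervalIntegrable ?_ ?_
  · apply ContinuousOn.intervalIntegrable
    rw [Set.uIcc_of_le zero_le_one]
    simp only [norm_gradientWithin]
    exact continuousOn_const.mul hcF'.norm
  · intro t _
    rw [norm_gradientWithin, mul_comm]
    exact (fderivWithin ℝ F S (AffineMap.lineMap y₀ y₁ t)).le_opNorm (y₁ - y₀)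

lemma hasSlopeBound_onHalfSpace {F : EuclideanSpace ℝ (Fin (d + 1)) → ℝ}
    (hF : ContDiffOn ℝ ∞ F (halfSpace d)) :
    HasSlopeBound √(d + 1 : ℝ) (onHalfSpace F)
      (onHalfSpace fun y => ‖gradientWithin F (halfSpace d) y‖) := by
  intro s₀ s₁ x₀ x₁ r h₀ h₁ hs hx
  have hint : ∫ t in (0 : ℝ)..1, onHalfSpace (fun y => ‖gradientWithin F (halfSpace d) y‖)
        (s₀ + t * (s₁ - s₀)) (x₀ + t • (x₁ - x₀))
      = ∫ t in (0 : ℝ)..1, ‖gradientWithin F (halfSpace d)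
        (AffineMap.lineMap (heightPoint s₀ x₀) (heightPoint s₁ x₁) t)‖ := by
    refine intervalIntegral.integral_congr fun t ht => ?_
    rw [Set.uIcc_of_le zero_le_one] at ht
    have hnn : 0 ≤ s₀ + t * (s₁ - s₀) := by nlinarith [ht.1, ht.2]
    simp only [onHalfSpace, max_eq_left hnn, heightPoint_lineMap]
  rw [hint]
  simp only [onHalfSpace, max_eq_left h₀, max_eq_left h₁]
  refine (abs_sub_le_norm_mul_integral_gradientWithin convex_halfSpace
    (hF.differentiableOn (by simp)) (hF.continuousOn_fderivWithin uniqueDiffOn_halfSpace (by simp))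
    (heightPoint_mem_halfSpace h₀ x₀) (heightPoint_mem_halfSpace h₁ x₁)).trans ?_
  refine mul_le_mul_of_nonneg_right (norm_heightPoint_sub_le hs hx) ?_
  exact intervalIntegral.integral_nonneg zero_le_one fun _ _ => norm_nonneg _

lemma measurePreserving_heightPoint :
    MeasurePreserving fun z : ℝ × (Fin d → ℝ) => heightPoint z.1 z.2 := by
  have h := (PiLp.volume_preserving_toLp (Fin (d + 1))).comp
    (volume_preserving_piFinSuccAbove (fun _ : Fin (d + 1) => ℝ) (Fin.last d)).symm
  convert h using 1
  ext z i
  refine Fin.lastCases ?_ (fun i => ?_) i <;> simp [MeasurableEquiv.piFinSuccAbove]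

lemma measurableEmbedding_heightPoint :
    MeasurableEmbedding fun z : ℝ × (Fin d → ℝ) => heightPoint z.1 z.2 := by
  have h := (MeasurableEquiv.toLp 2 (Fin (d + 1) → ℝ)).measurableEmbedding.comp
    (MeasurableEquiv.piFinSuccAbove (fun _ : Fin (d + 1) => ℝ) (Fin.last d)).symm.measurableEmbedding
  convert h using 1
  ext z i
  refine Fin.lastCases ?_ (fun i => ?_) i <;> simp [MeasurableEquiv.piFinSuccAbove]

end HalfSpace

/-! ### Dyadic cubes -/

/-- The dyadic cubes, as a property of a corner and a side length. -/
def IsDyadic {d : ℕ} (p : Fin d → ℝ) (ℓ : ℝ) : Prop :=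
  ∃ (m : ℤ) (j : Fin d → ℤ), ℓ = 2 ^ m ∧ p = fun i => 2 ^ m * (j i : ℝ)

section Dyadic

variable {d : ℕ}

lemma IsDyadic.pos {p : Fin d → ℝ} {ℓ : ℝ} (h : IsDyadic p ℓ) : 0 < ℓ := by
  obtain ⟨m, j, rfl, -⟩ := h
  positivity

lemma IsDyadic.child {p : Fin d → ℝ} {ℓ : ℝ} (h : IsDyadic p ℓ) (e : Fin d → Fin 2) :
    IsDyadic (childCorner p ℓ e) (ℓ / 2) := by
  obtain ⟨m, j, rfl, rfl⟩ := h
  have h2 : (2 : ℝ) ^ (m - 1) = 2 ^ m / 2 := zpow_sub_one₀ (by norm_num) m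
  refine ⟨m - 1, fun i => 2 * j i + ((e i : ℕ) : ℤ), h2.symm, ?_⟩
  ext i
  simp only [childCorner, h2]
  push_cast
  ring

lemma toLp_preimage_dyadicCube (m : ℤ) (j : Fin d → ℤ) :
    WithLp.toLp 2 ⁻¹' dyadicCube m j = cornerCube (fun i => 2 ^ m * (j i : ℝ)) (2 ^ m) := by
  ext x
  simp only [Set.mem_preimage, dyadicCube, Set.mem_ofPred_eq, Set.mem_Icc, mem_cornerCube]
  exact forall_congr' fun i => by rw [mul_add, mul_one]

lemma setIntegral_dyadicCube (m : ℤ) (j : Fin d → ℤ) (g : EuclideanSpace ℝ (Fin d) → ℝ) :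
    ∫ x in dyadicCube m j, g x
      = ∫ x in cornerCube (fun i => 2 ^ m * (j i : ℝ)) (2 ^ m), g (WithLp.toLp 2 x) := by
  rw [← toLp_preimage_dyadicCube]
  exact ((PiLp.volume_preserving_toLp (Fin d)).setIntegral_preimage_emb
    (MeasurableEquiv.toLp 2 (Fin d → ℝ)).measurableEmbedding g _).symm

lemma volume_real_dyadicCube (m : ℤ) (j : Fin d → ℤ) :
    volume.real (dyadicCube m j) = ((2 : ℝ) ^ m) ^ d := by
  rw [← volume_real_cornerCube (fun i => 2 ^ m * (j i : ℝ)) (by positivity),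
    ← toLp_preimage_dyadicCube, Measure.real, Measure.real]
  congr 1
  exact ((PiLp.volume_preserving_toLp (Fin d)).measure_preimage_emb
    (MeasurableEquiv.toLp 2 (Fin d → ℝ)).measurableEmbedding _).symm

lemma dist_le_of_mem_dyadicCube {m : ℤ} {j : Fin d → ℤ} {x y : EuclideanSpace ℝ (Fin d)}
    (hx : x ∈ dyadicCube m j) (hy : y ∈ dyadicCube m j) : dist x y ≤ √(d : ℝ) * 2 ^ m := by
  have h2 : (0 : ℝ) ≤ 2 ^ m := by positivity
  rw [EuclideanSpace.dist_eq, ← Real.sqrt_sq h2, ← Real.sqrt_mul (by positivity)]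
  apply Real.sqrt_le_sqrt
  have h : ∀ i, dist (x i) (y i) ^ 2 ≤ ((2 : ℝ) ^ m) ^ 2 := by
    intro i
    refine pow_le_pow_left₀ dist_nonneg ?_ 2
    have hxi := hx i
    have hyi := hy i
    rw [Set.mem_Icc] at hxi hyi
    rw [Real.dist_eq, abs_le]
    constructor <;> linarith
  calc _ ≤ ∑ _i : Fin d, ((2 : ℝ) ^ m) ^ 2 := Finset.sum_le_sum fun i _ => h i
    _ = _ := by simp

lemma diam_dyadicCube_le (m : ℤ) (j : Fin d → ℤ) :
    Metric.diam (dyadicCube m j) ≤ √(d : ℝ) * 2 ^ m :=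
  Metric.diam_le_of_forall_dist_le (by positivity) fun _ hx _ hy => dist_le_of_mem_dyadicCube hx hy

lemma le_diam_dyadicCube (hd : 0 < d) (m : ℤ) (j : Fin d → ℤ) :
    (2 : ℝ) ^ m ≤ Metric.diam (dyadicCube m j) := by
  have h2 : (0 : ℝ) < 2 ^ m := by positivity
  let x : EuclideanSpace ℝ (Fin d) := WithLp.toLp 2 fun i => 2 ^ m * (j i : ℝ)
  let y : EuclideanSpace ℝ (Fin d) := WithLp.toLp 2 fun i => 2 ^ m * ((j i : ℝ) + 1)
  have hx : x ∈ dyadicCube m j := fun i => ⟨le_rfl, by simp only [x]; nlinarith⟩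
  have hy : y ∈ dyadicCube m j := fun i => ⟨by simp only [y]; nlinarith, le_rfl⟩
  have hb : Bornology.IsBounded (dyadicCube m j) :=
    Metric.isBounded_iff.2 ⟨_, fun _ hx _ hy => dist_le_of_mem_dyadicCube hx hy⟩
  refine le_trans ?_ (Metric.dist_le_diam_of_mem hb hy hx)
  rw [dist_eq_norm]
  refine le_trans ?_ (PiLp.norm_apply_le (y - x) ⟨0, hd⟩)
  refine le_trans (le_of_eq ?_) (le_abs_self _)
  simp only [x, y, PiLp.sub_apply]
  ring

/-- The energy of the box of height `2 ^ m` is part of the energy of a higher cylinder. -/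
lemma slabEnergy_le_setIntegral_cubeCylinder {g : EuclideanSpace ℝ (Fin (d + 1)) → ℝ}
    (hg : ContinuousOn g (halfSpace d)) (m : ℤ) (j : Fin d → ℤ) {h : ℝ} (hh : (2 : ℝ) ^ m ≤ h) :
    slabEnergy (onHalfSpace g) (fun i => 2 ^ m * (j i : ℝ)) (2 ^ m) 0 (2 ^ m)
      ≤ ∫ x in cubeCylinder (dyadicCube m j) h, g x ^ 2 := by
  have h2 : (0 : ℝ) < 2 ^ m := by positivity
  set p : Fin d → ℝ := fun i => 2 ^ m * (j i : ℝ) with hp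
  have hpre : (fun z : ℝ × (Fin d → ℝ) => heightPoint z.1 z.2) ⁻¹' cubeCylinder (dyadicCube m j) h
      = Set.Icc 0 h ×ˢ cornerCube p (2 ^ m) := by
    ext z
    rw [hp, ← toLp_preimage_dyadicCube]
    simp only [Set.mem_preimage, cubeCylinder, Set.mem_ofPred_eq, heightPoint_castSucc,
      heightPoint_last, Set.mem_prod]
    exact and_comm
  have hcont := continuous_onHalfSpace hg
  have hc := continuous_integral_sq hcont p (2 ^ m)
  have hcyl : ∫ x in cubeCylinder (dyadicCube m j) h, g x ^ 2
      = slabEnergy (onHalfSpace g) p (2 ^ m) 0 h := by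
    rw [← measurePreserving_heightPoint.setIntegral_preimage_emb measurableEmbedding_heightPoint,
      hpre]
    have hcongr : ∫ z in Set.Icc 0 h ×ˢ cornerCube p (2 ^ m), g (heightPoint z.1 z.2) ^ 2
        = ∫ z in Set.Icc 0 h ×ˢ cornerCube p (2 ^ m), onHalfSpace g z.1 z.2 ^ 2 := by
      refine setIntegral_congr_fun (measurableSet_Icc.prod (measurableSet_cornerCube _ _)) ?_
      intro z hz
      simp only [onHalfSpace, max_eq_left hz.1.1]
    rw [hcongr, Measure.volume_eq_prod, setIntegral_prod, integral_Icc_eq_integral_Ioc, slabEnergy,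
      intervalIntegral.integral_of_le (h2.le.trans hh)]
    exact (hcont.pow 2).continuousOn.integrableOn_compact
      (isCompact_Icc.prod (isCompact_cornerCube _ _))
  rw [hcyl]
  exact intervalIntegral.integral_mono_interval le_rfl h2.le hh
    (Filter.Eventually.of_forall fun s => integral_nonneg fun _ => sq_nonneg _)
    (hc.intervalIntegrable _ _)

/-- Hölder's inequality lowers the exponent in the normalized Morrey bound. -/
lemma morrey_bound_of_le {V : (Fin d → ℝ) → ℝ} (hV : Continuous V) (hV0 : ∀ x, 0 ≤ V x)
    {s σ : ℝ} (hs : 0 < s) (hsσ : s ≤ σ) (p : Fin d → ℝ) {ℓ : ℝ} (hℓ : 0 < ℓ)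
    (h : ((ℓ ^ d)⁻¹ * ∫ x in cornerCube p ℓ, V x ^ σ) ^ (1 / σ) ≤ ℓ⁻¹) :
    ℓ ^ s * ((ℓ ^ d)⁻¹ * ∫ x in cornerCube p ℓ, V x ^ s) ≤ 1 := by
  have hσ : 0 < σ := hs.trans_le hsσ
  set a := (ℓ ^ d)⁻¹ * ∫ x in cornerCube p ℓ, V x ^ σ with ha
  have ha0 : 0 ≤ a :=
    mul_nonneg (by positivity) (integral_nonneg fun x => Real.rpow_nonneg (hV0 x) _)
  have hb0 : 0 ≤ (ℓ ^ d)⁻¹ * ∫ x in cornerCube p ℓ, V x ^ s :=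
    mul_nonneg (by positivity) (integral_nonneg fun x => Real.rpow_nonneg (hV0 x) _)
  have h1 : ℓ ^ σ * a ≤ 1 := by
    have := Real.rpow_le_rpow (by positivity) h hσ.le
    rw [← Real.rpow_mul ha0, one_div_mul_cancel hσ.ne', Real.rpow_one, Real.inv_rpow hℓ.le] at this
    exact (mul_le_mul_of_nonneg_left this (by positivity)).trans_eq
      (mul_inv_cancel₀ (by positivity))
  have h2 := rpow_average_le (hV.rpow_const fun x => Or.inr hs.le)
    (fun x => Real.rpow_nonneg (hV0 x) s) ((one_le_div hs).2 hsσ) p hℓ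
  have h3 : ∀ x, (V x ^ s) ^ (σ / s) = V x ^ σ := fun x => by
    rw [← Real.rpow_mul (hV0 x), mul_div_cancel₀ _ hs.ne']
  simp only [h3, ← ha] at h2
  by_contra! hlt
  have h4 := Real.one_lt_rpow hlt (div_pos hσ hs)
  rw [Real.mul_rpow (by positivity) hb0, ← Real.rpow_mul hℓ.le, mul_div_cancel₀ _ hs.ne'] at h4
  have h5 := mul_le_mul_of_nonneg_left h2 (by positivity : 0 ≤ ℓ ^ σ)
  linarith

end Dyadic

/-- Here `d = n - 1`, so `d ≥ 2` is `n ≥ 3`, and the half-space lies in `ℝ^n = ℝ^(d+1)`. The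
hyperplane `ℝ^(n-1) × {0}` is identified with `ℝ^d`. Smoothness on the half-space is smoothness up
to the boundary, and the gradient is the one relative to the half-space. -/
theorem theoremA1 (d : ℕ) (hd : 2 ≤ d) (σ : ℝ) (hσ : 1 < σ) (hσd : σ < (d : ℝ)) :
    ∃ C : ℝ, 0 < C ∧
      ∀ V : EuclideanSpace ℝ (Fin d) → ℝ, Continuous V → (∀ x, 0 ≤ V x) →
        (∀ Q ∈ dyadicCubes d,
          ((volume.real Q)⁻¹ * ∫ x in Q, V x ^ σ) ^ (1 / σ) ≤ (Metric.diam Q)⁻¹) →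
        ∀ F : EuclideanSpace ℝ (Fin (d + 1)) → ℝ, ContDiffOn ℝ ∞ F (halfSpace d) →
          ∀ Q ∈ dyadicCubes d,
            ∫ x in Q, V x * F (boundaryPoint x) ^ 2 ≤
              C * (∫ x in cubeCylinder Q (Metric.diam Q), ‖gradientWithin F (halfSpace d) x‖ ^ 2) +
                C * (Metric.diam Q)⁻¹ * ∫ x in Q, F (boundaryPoint x) ^ 2 := by
  set s := min σ 2 with hs
  have hs1 : 1 < s := lt_min hσ (by norm_num)
  have hκ : 0 < 1 - (1 / 2 : ℝ) ^ (s - 1) :=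
    sub_pos.2 (Real.rpow_lt_one (by norm_num) (by norm_num) (by linarith))
  set A := (4 / (1 - (1 / 2 : ℝ) ^ (s - 1)) + 2) * (√(d + 1 : ℝ) ^ 2 * 2 ^ d)
    + 4 * √(d + 1 : ℝ) ^ 2 with hA
  have hA0 : 0 < A := by positivity
  have hd0 : 0 < d := by omega
  have hdR : 0 < √(d : ℝ) := Real.sqrt_pos.2 (by exact_mod_cast hd0)
  refine ⟨A + 4 * √(d : ℝ), by positivity, ?_⟩
  rintro V hV hV0 hVQ F hF _ ⟨m, j, rfl⟩
  have h2 : (0 : ℝ) < 2 ^ m := by positivity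
  have hgrad := continuousOn_norm_gradientWithin hF
  have hV' : Continuous fun x : Fin d → ℝ => V (WithLp.toLp 2 x) :=
    hV.comp (PiLp.continuous_toLp 2 _)
  have hmain := integral_mul_sq_le_slabEnergy (D := IsDyadic) hV' (fun x => hV0 _) hs1
    (min_le_right _ _) (continuous_onHalfSpace hF.continuousOn) (continuous_onHalfSpace hgrad)
    (hasSlopeBound_onHalfSpace hF) (fun _ _ h => h.pos) (fun _ _ h => h.child) (by
      rintro _ _ ⟨m', j', rfl, rfl⟩
      have h2' : (0 : ℝ) < 2 ^ m' := by positivity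
      refine morrey_bound_of_le hV' (fun x => hV0 _) (by linarith) (min_le_left _ _) _ h2' ?_
      have h := hVQ _ ⟨m', j', rfl⟩
      rw [volume_real_dyadicCube, setIntegral_dyadicCube] at h
      exact h.trans (inv_anti₀ h2' (le_diam_dyadicCube hd0 m' j')))
    _ _ ⟨m, j, rfl, rfl⟩
  have hbdry : ∀ x : Fin d → ℝ,
      F (boundaryPoint (WithLp.toLp 2 x)) = onHalfSpace F 0 x := fun x => by
    rw [boundaryPoint_toLp, onHalfSpace, max_self]
  simp only [setIntegral_dyadicCube m j, hbdry]
  have hdiam := le_diam_dyadicCube hd0 m j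
  have henergy := slabEnergy_le_setIntegral_cubeCylinder hgrad m j hdiam
  have hD0 : 0 < Metric.diam (dyadicCube m j) := h2.trans_le hdiam
  have hinv : ((2 : ℝ) ^ m)⁻¹ ≤ √(d : ℝ) * (Metric.diam (dyadicCube m j))⁻¹ := by
    rw [← div_eq_mul_inv, le_div_iff₀ hD0, inv_mul_le_iff₀ h2, mul_comm]
    exact diam_dyadicCube_le m j
  set I := ∫ x in cubeCylinder (dyadicCube m j) (Metric.diam (dyadicCube m j)),
    ‖gradientWithin F (halfSpace d) x‖ ^ 2
  set J := ∫ x in cornerCube (fun i => 2 ^ m * (j i : ℝ)) (2 ^ m), onHalfSpace F 0 x ^ 2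
  have hI : 0 ≤ I := integral_nonneg fun _ => sq_nonneg _
  have hJ : 0 ≤ J := integral_nonneg fun _ => sq_nonneg _
  refine hmain.trans (add_le_add ?_ ?_)
  · exact (mul_le_mul_of_nonneg_left henergy hA0.le).trans
      (mul_le_mul_of_nonneg_right (by linarith) hI)
  · refine mul_le_mul_of_nonneg_right ?_ hJ
    have hDi : 0 < (Metric.diam (dyadicCube m j))⁻¹ := inv_pos.2 hD0
    nlinarith [mul_pos hA0 hDi]
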